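/- Let $\mu>0$ and consider the system $z(k)=A(k)\otimes z(k-1)$, $k\ge 1$, with $z(k)=(x(k),y(k))^{T}\in\mathbb{R}^2$ and $z(0)=(0,0)^{T}$, where $\otimes$ is the matrix-vector product over the semiring of real numbers with maximum as addition and ordinary addition as multiplication. That is, for $A(k)=\begin{pmatrix} a_k & b_k\\ c_k & d_k\end{pmatrix}$, $$x(k)=\max(x(k-1)+a_k,\;y(k-1)+b_k),\qquad y(k)=\max(x(k-1)+c_k,\;y(k-1)+d_k).$$ The Lyapunov exponent of the system is the almost sure limit $\lambda=\lim_{k\to\infty}\frac1k\max(x(k),y(k))$. (1) Let $\nu>0$ and let $\alpha_1,\alpha_2,\dots,\beta_1,\beta_2,\dots$ be mutually independent random variables, with each $\alpha_k$ exponentially distributed with parameter (rate) $\mu$ and each $\beta_k$ exponentially distributed with parameter $\nu$. If $A(k)=\begin{pmatrix}\alpha_k&\beta_k\\0&0\end{pmatrix}$ (the entries $0$ being the real number zero), then the Lyapunov exponent exists and equals $$\lambda=\frac{2\mu^{4}+7\mu^{3}\nu+10\mu^{2}\nu^{2}+11\mu\nu^{3}+4\nu^{4}}{\mu\nu(\mu+\nu)^{2}(3\mu+4\nu)}.$$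 (2) Let $\sigma>0$ and let $\alpha_1,\alpha_2,\dots,\gamma_1,\gamma_2,\dots$ be mutually independent random variables, with each $\alpha_k$ exponentially distributed with parameter $\mu$ and each $\gamma_k$ exponentially distributed with parameter $\sigma$. If $A(k)=\begin{pmatrix}\alpha_k&0\\\gamma_k&0\end{pmatrix}$, then the Lyapunov exponent exists and equals $$\lambda=\frac{2\mu^{4}+7\mu^{3}\sigma+10\mu^{2}\sigma^{2}+11\mu\sigma^{3}+4\sigma^{4}}{\mu\sigma(\mu+\sigma)^{2}(3\mu+4\sigma)}.$$ -/

import Mathlib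

open MeasureTheory ProbabilityTheory Filter Topology

/-- Matrix-vector product for second-order matrices over the semiring of real numbers with
maximum as addition and ordinary addition as multiplication. -/
noncomputable def maxPlusMulVec (A : Matrix (Fin 2) (Fin 2) ℝ) (z : Fin 2 → ℝ) : Fin 2 → ℝ :=
  fun i => max (z 0 + A i 0) (z 1 + A i 1)

/-- The state vector `z(k)` of the system `z(k) = A(k) z(k-1)`, `z(0) = (0, 0)`, driven by a
sequence of random matrices. Sequences are indexed from zero here: `A k` is the transition
matrix of step `k + 1`. -/
noncomputable def stateVector {Ω : Type*} (A : ℕ → Ω → Matrix (Fin 2) (Fin 2) ℝ) :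
    ℕ → Ω → Fin 2 → ℝ
  | 0, _ => 0
  | k + 1, ω => maxPlusMulVec (A k ω) (stateVector A k ω)

/-- `lam` is the Lyapunov exponent of the system driven by `A`: with probability one,
`(1 / k) max (x(k), y(k))` converges to `lam`, where `z(k) = (x(k), y(k))`. -/
def IsLyapunovExponent {Ω : Type*} [MeasurableSpace Ω] (P : Measure Ω)
    (A : ℕ → Ω → Matrix (Fin 2) (Fin 2) ℝ) (lam : ℝ) : Prop :=
  ∀ᵐ ω ∂P, Tendsto
    (fun k : ℕ => (1 / (k : ℝ)) * max (stateVector A k ω 0) (stateVector A k ω 1))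
    atTop (𝓝 lam)

/-!
In both systems one coordinate `u` of the state satisfies the second-order recursion
`u (n + 2) = max (u (n + 1) + a n) (u n + b n)` with `a n ∼ Exp(μ)` and `b n ∼ Exp(ν)` independent
of the past, and `max (x(n), y(n))` lies between `u n` and `u (n + 1)`. The increments
`D n = u (n + 1) - u n ≥ 0` form the Markov chain `D (n + 1) = max (a n) (b n - D n)`.

Given `D n = d`, with probability `q = exp (-ν d)` one has `b n > d`, and then `b n - d ∼ Exp(ν)` by
memorylessness; since `min (Exp(μ), Exp(ν)) ∼ Exp(μ + ν)`, the law of `D (n + 1)` is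
`Exp(μ) + q (Exp(ν) - Exp(μ + ν))`. Its dependence on `d` is through `q` alone, so the Poisson
equation `E (D (n + 1) + h (D (n + 1)) | D n = d) = λ + h d` is solved by `h d = θ exp (-ν d)`, and
the equation determines `θ` and `λ`. Hence `D (n + 1) + h (D (n + 1)) - λ - h (D n)` are martingale
differences with bounded second moments. Their averages vanish almost surely (L² martingale
convergence and Kronecker's lemma), and as `h` is bounded, `u n / n → λ`.
-/

section Independence

variable {Ω S E : Type*} {m mΩ : MeasurableSpace Ω} [MeasurableSpace S] [mE : MeasurableSpace E]
  {F : Type*} [NormedAddCommGroup F] [NormedSpace ℝ F] [CompleteSpace F]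
  {P : Measure Ω} [IsFiniteMeasure P] {X : Ω → S} {W : Ω → E}

theorem map_prodMk_restrict_of_indep (hm : m ≤ mΩ) (hX : Measurable[m] X) (hW : Measurable W)
    (hind : Indep m (mE.comap W) P) {s : Set Ω} (hs : MeasurableSet[m] s) :
    (P.restrict s).map (fun ω => (X ω, W ω)) = ((P.restrict s).map X).prod (P.map W) := by
  have hX' : Measurable X := hX.mono hm le_rfl
  refine (Measure.prod_eq fun A B hA hB => ?_).symm
  rw [Measure.map_apply (hX'.prodMk hW) (hA.prod hB), Measure.map_apply hX' hA,
    Measure.map_apply hW hB, Measure.restrict_apply (hX' hA),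
    Measure.restrict_apply ((hX'.prodMk hW) (hA.prod hB)), Set.mk_preimage_prod,
    Set.inter_right_comm]
  exact (Indep_iff m _ P).1 hind _ _ ((hX hA).inter hs) ⟨B, hB, rfl⟩

theorem condExp_comp_prodMk_of_indep (hm : m ≤ mΩ) (hX : Measurable[m] X) (hW : Measurable W)
    (hind : Indep m (mE.comap W) P) {φ : S × E → F} (hφ : StronglyMeasurable φ)
    (hint : Integrable (fun ω => φ (X ω, W ω)) P) :
    P[fun ω => φ (X ω, W ω) | m] =ᵐ[P] fun ω => ∫ w, φ (X ω, w) ∂P.map W := by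
  have hX' : Measurable X := hX.mono hm le_rfl
  have hXW : Measurable fun ω => (X ω, W ω) := hX'.prodMk hW
  have hmean : StronglyMeasurable fun x => ∫ w, φ (x, w) ∂P.map W :=
    hφ.integral_prod_right'
  have hint_prod {s : Set Ω} (hs : MeasurableSet[m] s) :
      Integrable φ (((P.restrict s).map X).prod (P.map W)) := by
    rw [← map_prodMk_restrict_of_indep hm hX hW hind hs,
      integrable_map_measure hφ.aestronglyMeasurable hXW.aemeasurable]
    exact hint.restrict
  refine (ae_eq_condExp_of_forall_setIntegral_eq hm hint (fun s hs _ => ?_) (fun s hs _ => ?_)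
    (hmean.comp_measurable hX).aestronglyMeasurable).symm
  · exact (hint_prod hs).integral_prod_left.comp_measurable hX'
  · calc ∫ ω in s, ∫ w, φ (X ω, w) ∂P.map W ∂P
      _ = ∫ x, ∫ w, φ (x, w) ∂P.map W ∂(P.restrict s).map X :=
        (integral_map hX'.aemeasurable hmean.aestronglyMeasurable).symm
      _ = ∫ p, φ p ∂((P.restrict s).map X).prod (P.map W) := (integral_prod _ (hint_prod hs)).symm
      _ = ∫ ω in s, φ (X ω, W ω) ∂P := by
        rw [← map_prodMk_restrict_of_indep hm hX hW hind hs,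
          integral_map hXW.aemeasurable hφ.aestronglyMeasurable]

end Independence

section Martingale

variable {Ω : Type*} {mΩ : MeasurableSpace Ω} {P : Measure Ω} [IsFiniteMeasure P]

theorem integral_mul_eq_zero_of_condExp_eq_zero {m : MeasurableSpace Ω} (hm : m ≤ mΩ)
    {f g : Ω → ℝ} (hf : StronglyMeasurable[m] f) (hfL : MemLp f 2 P) (hgL : MemLp g 2 P)
    (hg : P[g | m] =ᵐ[P] 0) : ∫ ω, f ω * g ω ∂P = 0 := by
  have hpull : P[f * g | m] =ᵐ[P] f * P[g | m] :=
    condExp_mul_of_stronglyMeasurable_left hf (hfL.integrable_mul hgL)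
      (hgL.integrable one_le_two)
  calc ∫ ω, f ω * g ω ∂P
    _ = ∫ ω, P[f * g | m] ω ∂P := (integral_condExp hm).symm
    _ = 0 := integral_eq_zero_of_ae (by
      filter_upwards [hpull, hg] with ω h1 h2
      simp [h1, h2])

variable {ℱ : Filtration ℕ mΩ} {ξ : ℕ → Ω → ℝ}

theorem integral_sq_sum_eq_of_condExp_eq_zero (hξm : ∀ n, StronglyMeasurable[ℱ (n + 1)] (ξ n))
    (hξL : ∀ n, MemLp (ξ n) 2 P) (hξ : ∀ n, P[ξ n | ℱ n] =ᵐ[P] 0) (n : ℕ) :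
    ∫ ω, (∑ k ∈ Finset.range n, ξ k ω) ^ 2 ∂P = ∑ k ∈ Finset.range n, ∫ ω, ξ k ω ^ 2 ∂P := by
  induction n with
  | zero => simp
  | succ n ih =>
    set S : Ω → ℝ := fun ω => ∑ k ∈ Finset.range n, ξ k ω with hS
    have hSm : StronglyMeasurable[ℱ n] S :=
      Finset.stronglyMeasurable_fun_sum _ fun k hk =>
        (hξm k).mono (ℱ.mono (Finset.mem_range.1 hk))
    have hSL : MemLp S 2 P := memLp_finsetSum _ fun k _ => hξL k
    have horth : ∫ ω, S ω * ξ n ω ∂P = 0 :=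
      integral_mul_eq_zero_of_condExp_eq_zero (ℱ.le n) hSm hSL (hξL n) (hξ n)
    have hSξ : Integrable (fun ω => 2 * (S ω * ξ n ω)) P :=
      (hSL.integrable_mul (hξL n)).const_mul 2
    have hSS : Integrable (fun ω => S ω ^ 2 + 2 * (S ω * ξ n ω)) P := hSL.integrable_sq.add hSξ
    calc ∫ ω, (∑ k ∈ Finset.range (n + 1), ξ k ω) ^ 2 ∂P
      _ = ∫ ω, (S ω ^ 2 + 2 * (S ω * ξ n ω) + ξ n ω ^ 2) ∂P := by
        simp only [hS, Finset.sum_range_succ]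
        congr 1 with ω
        ring
      _ = ∑ k ∈ Finset.range (n + 1), ∫ ω, ξ k ω ^ 2 ∂P := by
        rw [integral_add hSS (hξL n).integrable_sq,
          integral_add hSL.integrable_sq hSξ, integral_const_mul, horth, ih,
          Finset.sum_range_succ]
        ring

theorem martingale_sum_of_condExp_eq_zero (hξm : ∀ n, StronglyMeasurable[ℱ (n + 1)] (ξ n))
    (hξi : ∀ n, Integrable (ξ n) P) (hξ : ∀ n, P[ξ n | ℱ n] =ᵐ[P] 0) :
    Martingale (fun n ω => ∑ k ∈ Finset.range n, ξ k ω) ℱ P := by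
  refine martingale_of_condExp_sub_eq_zero_nat (fun n => ?_)
    (fun n => integrable_finsetSum _ fun k _ => hξi k) fun n => ?_
  · exact Finset.stronglyMeasurable_fun_sum _ fun k hk =>
      (hξm k).mono (ℱ.mono (Finset.mem_range.1 hk))
  · convert hξ n using 2
    ext ω
    simp [Finset.sum_range_succ]

theorem exists_ae_tendsto_sum_of_summable_integral_sq
    (hξm : ∀ n, StronglyMeasurable[ℱ (n + 1)] (ξ n)) (hξL : ∀ n, MemLp (ξ n) 2 P)
    (hξ : ∀ n, P[ξ n | ℱ n] =ᵐ[P] 0) (hsum : Summable fun n => ∫ ω, ξ n ω ^ 2 ∂P) :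
    ∀ᵐ ω ∂P, ∃ l, Tendsto (fun n => ∑ k ∈ Finset.range n, ξ k ω) atTop (𝓝 l) := by
  set S : ℕ → Ω → ℝ := fun n ω => ∑ k ∈ Finset.range n, ξ k ω
  have hSL (n : ℕ) : MemLp (S n) 2 P := memLp_finsetSum _ fun k _ => hξL k
  have hSi (n : ℕ) : Integrable (S n) P := (hSL n).integrable one_le_two
  have hnorm (n : ℕ) : ∫ ω, ‖S n ω‖ ∂P ≤ ∫ ω, (1 + S n ω ^ 2) ∂P := by
    refine integral_mono (hSi n).norm ((integrable_const 1).add (hSL n).integrable_sq) fun ω => ?_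
    have := sq_nonneg (|S n ω| - 1)
    simp only [Real.norm_eq_abs, ← sq_abs (S n ω)]
    nlinarith [abs_nonneg (S n ω)]
  have hsq (n : ℕ) : ∫ ω, S n ω ^ 2 ∂P ≤ ∑' k, ∫ ω, ξ k ω ^ 2 ∂P := by
    rw [integral_sq_sum_eq_of_condExp_eq_zero hξm hξL hξ]
    exact hsum.sum_le_tsum _ fun k _ => integral_nonneg fun ω => sq_nonneg _
  have hL1 (n : ℕ) : eLpNorm (S n) 1 P ≤
      (P.real Set.univ + ∑' k, ∫ ω, ξ k ω ^ 2 ∂P).toNNReal := by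
    rw [eLpNorm_one_eq_lintegral_enorm, ← ofReal_integral_norm_eq_lintegral_enorm (hSi n)]
    refine ENNReal.ofReal_le_ofReal ((hnorm n).trans ?_)
    rw [integral_add (integrable_const 1) (hSL n).integrable_sq, integral_const]
    simpa using hsq n
  have hmart : Martingale S ℱ P :=
    martingale_sum_of_condExp_eq_zero hξm (fun n => (hξL n).integrable one_le_two) hξ
  filter_upwards [hmart.submartingale.ae_tendsto_limitProcess hL1] with ω hω
  exact ⟨_, hω⟩

theorem tendsto_average_zero_of_tendsto_sum_div_succ {x : ℕ → ℝ} {l : ℝ}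
    (h : Tendsto (fun n => ∑ k ∈ Finset.range n, x k / (k + 1)) atTop (𝓝 l)) :
    Tendsto (fun n : ℕ => (∑ k ∈ Finset.range n, x k) / n) atTop (𝓝 0) := by
  set s : ℕ → ℝ := fun n => ∑ k ∈ Finset.range n, x k / (k + 1)
  have abel (n : ℕ) : ∑ k ∈ Finset.range n, x k = n * s n - ∑ k ∈ Finset.range n, s k := by
    induction n with
    | zero => simp
    | succ n ih =>
      have hs : s (n + 1) = s n + x n / (n + 1) := Finset.sum_range_succ _ _
      rw [Finset.sum_range_succ, ih, Finset.sum_range_succ, hs]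
      push_cast
      field_simp
      ring
  have := h.sub h.cesaro
  rw [sub_self] at this
  refine this.congr' ?_
  filter_upwards [eventually_ne_atTop 0] with n hn
  rw [abel]
  field_simp

theorem ae_tendsto_average_zero_of_condExp_eq_zero
    (hξm : ∀ n, StronglyMeasurable[ℱ (n + 1)] (ξ n)) (hξL : ∀ n, MemLp (ξ n) 2 P)
    (hξ : ∀ n, P[ξ n | ℱ n] =ᵐ[P] 0) {C : ℝ} (hC : ∀ n, ∫ ω, ξ n ω ^ 2 ∂P ≤ C) :
    ∀ᵐ ω ∂P, Tendsto (fun n : ℕ => (∑ k ∈ Finset.range n, ξ k ω) / n) atTop (𝓝 0) := by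
  have hdiv (n : ℕ) : (fun ω => ξ n ω / (n + 1)) = ((n : ℝ) + 1)⁻¹ • ξ n := by
    ext ω
    simp [div_eq_inv_mul]
  have hconv : ∀ᵐ ω ∂P, ∃ l,
      Tendsto (fun n : ℕ => ∑ k ∈ Finset.range n, ξ k ω / (k + 1)) atTop (𝓝 l) := by
    refine exists_ae_tendsto_sum_of_summable_integral_sq (ℱ := ℱ)
      (ξ := fun n ω => ξ n ω / (n + 1)) (fun n => ?_) (fun n => ?_) (fun n => ?_) ?_
    · exact hdiv n ▸ (hξm n).const_smul _
    · exact hdiv n ▸ (hξL n).const_smul _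
    · rw [hdiv]
      filter_upwards [condExp_smul (μ := P) ((n : ℝ) + 1)⁻¹ (ξ n) (ℱ n), hξ n] with ω h1 h2
      simp [h1, h2]
    · have hbound : Summable fun n : ℕ => C * (1 / ((n + 1 : ℕ) : ℝ) ^ 2) :=
        ((summable_nat_add_iff 1).2 (Real.summable_one_div_nat_pow.2 one_lt_two)).mul_left C
      refine hbound.of_nonneg_of_le (fun n => integral_nonneg fun ω => sq_nonneg _) fun n => ?_
      simp only [div_pow, integral_div, mul_one_div]
      push_cast
      gcongr
      exact hC n
  filter_upwards [hconv] with ω ⟨l, hl⟩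
  exact tendsto_average_zero_of_tendsto_sum_div_succ hl

end Martingale

section Exponential

theorem expMeasure_eq_restrict_withDensity (r : ℝ) :
    expMeasure r = (volume.restrict (Set.Ioi 0)).withDensity
      fun x => (r * Real.exp (-(r * x))).toNNReal := by
  rw [Measure.restrict_congr_set Ioi_ae_eq_Ici, ← withDensity_indicator measurableSet_Ici]
  change volume.withDensity (exponentialPDF r) = _
  congr 1
  ext x
  by_cases hx : 0 ≤ x
  · rw [exponentialPDF_of_nonneg hx, Set.indicator_of_mem (Set.mem_Ici.2 hx), ENNReal.ofReal]
  · rw [exponentialPDF_of_neg (not_le.1 hx), Set.indicator_of_notMem (mt Set.mem_Ici.1 hx)]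

theorem ae_nonneg_expMeasure (r : ℝ) : ∀ᵐ x ∂(expMeasure r), 0 ≤ x := by
  rw [expMeasure_eq_restrict_withDensity]
  refine (withDensity_absolutelyContinuous _ _).ae_le ?_
  filter_upwards [ae_restrict_mem measurableSet_Ioi] with x hx
  exact le_of_lt hx

theorem integral_expMeasure {r : ℝ} (hr : 0 < r) (g : ℝ → ℝ) :
    ∫ x, g x ∂(expMeasure r) = ∫ x in Set.Ioi 0, r * Real.exp (-(r * x)) * g x := by
  rw [expMeasure_eq_restrict_withDensity, integral_withDensity_eq_integral_smul (by fun_prop)]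
  congr 1 with x
  rw [NNReal.smul_def, Real.coe_toNNReal _ (by positivity), smul_eq_mul]

theorem integrable_expMeasure_iff {r : ℝ} (hr : 0 < r) (g : ℝ → ℝ) :
    Integrable g (expMeasure r) ↔
      IntegrableOn (fun x => r * Real.exp (-(r * x)) * g x) (Set.Ioi 0) := by
  rw [expMeasure_eq_restrict_withDensity, integrable_withDensity_iff_integrable_smul (by fun_prop),
    IntegrableOn]
  congr! 2 with x
  rw [NNReal.smul_def, Real.coe_toNNReal _ (by positivity), smul_eq_mul]

theorem integral_id_expMeasure {r : ℝ} (hr : 0 < r) : ∫ x, x ∂(expMeasure r) = 1 / r := by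
  calc ∫ x, x ∂(expMeasure r)
    _ = ∫ x in Set.Ioi 0, r * (x ^ ((2 : ℝ) - 1) * Real.exp (-(r * x))) := by
      rw [integral_expMeasure hr]
      congr 1 with x
      norm_num
      ring
    _ = 1 / r := by
      rw [integral_const_mul, Real.integral_rpow_mul_exp_neg_mul_Ioi two_pos hr, Real.Gamma_two]
      norm_num
      field_simp

theorem integral_exp_expMeasure {r κ : ℝ} (hr : 0 < r) (hκ : 0 ≤ κ) :
    ∫ x, Real.exp (-(κ * x)) ∂(expMeasure r) = r / (r + κ) := by
  calc ∫ x, Real.exp (-(κ * x)) ∂(expMeasure r)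
    _ = ∫ x in Set.Ioi 0, r * Real.exp (-(r + κ) * x) := by
      rw [integral_expMeasure hr]
      congr 1 with x
      rw [mul_assoc, ← Real.exp_add]
      ring_nf
    _ = r / (r + κ) := by
      rw [integral_const_mul, integral_exp_mul_Ioi (by linarith), mul_zero, Real.exp_zero,
        neg_div_neg_eq, mul_one_div]

theorem memLp_two_id_expMeasure {r : ℝ} (hr : 0 < r) : MemLp (fun x : ℝ => x) 2 (expMeasure r) := by
  rw [memLp_two_iff_integrable_sq (by fun_prop), integrable_expMeasure_iff hr]
  refine ((integrableOn_rpow_mul_exp_neg_mul_rpow (s := 2) (p := 1) (by norm_num) one_pos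
    hr).const_mul r).congr (ae_of_all _ fun x => ?_)
  simp only [Real.rpow_ofNat, Real.rpow_one]
  ring_nf

theorem integrable_exp_expMeasure {r κ : ℝ} (hr : 0 < r) (hκ : 0 ≤ κ) :
    Integrable (fun x => Real.exp (-(κ * x))) (expMeasure r) := by
  have := isProbabilityMeasure_expMeasure hr
  refine Integrable.of_bound (by fun_prop) 1 ?_
  filter_upwards [ae_nonneg_expMeasure r] with x hx
  rw [Real.norm_eq_abs, Real.abs_exp]
  exact Real.exp_le_one_iff.2 (neg_nonpos.2 (mul_nonneg hκ hx))

theorem expMeasure_Iic {r : ℝ} (hr : 0 < r) (x : ℝ) :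
    expMeasure r (Set.Iic x) = ENNReal.ofReal (if 0 ≤ x then 1 - Real.exp (-(r * x)) else 0) := by
  have := isProbabilityMeasure_expMeasure hr
  rw [← cdf_expMeasure_eq hr, cdf_eq_real, ofReal_measureReal]

theorem map_max_sub_prod_expMeasure_add {μ ν d : ℝ} (hμ : 0 < μ) (hν : 0 < ν) (hd : 0 ≤ d) :
    ((expMeasure μ).prod (expMeasure ν)).map (fun w => max w.1 (w.2 - d)) +
        ENNReal.ofReal (Real.exp (-(ν * d))) • expMeasure (μ + ν) =
      expMeasure μ + ENNReal.ofReal (Real.exp (-(ν * d))) • expMeasure ν := by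
  have := isProbabilityMeasure_expMeasure hμ
  have := isProbabilityMeasure_expMeasure hν
  have := isProbabilityMeasure_expMeasure (add_pos hμ hν)
  have hfin (ρ : Measure ℝ) [IsProbabilityMeasure ρ] :
      IsFiniteMeasure (ENNReal.ofReal (Real.exp (-(ν * d))) • ρ) :=
    ρ.smul_finite ENNReal.ofReal_ne_top
  refine Measure.ext_of_Iic _ _ fun x => ?_
  have hpre : (fun w : ℝ × ℝ => max w.1 (w.2 - d)) ⁻¹' Set.Iic x =
      Set.Iic x ×ˢ Set.Iic (x + d) := by
    ext w
    simp [Prod.le_def]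
  simp only [Measure.add_apply, Measure.smul_apply, smul_eq_mul,
    Measure.map_apply (by fun_prop : Measurable fun w : ℝ × ℝ => max w.1 (w.2 - d))
      measurableSet_Iic, hpre, Measure.prod_prod, expMeasure_Iic hμ, expMeasure_Iic hν,
    expMeasure_Iic (add_pos hμ hν)]
  rcases lt_or_ge x 0 with hx | hx
  · simp [hx.not_ge]
  · have hcdf {s y : ℝ} (hs : 0 < s) (hy : 0 ≤ y) : 0 ≤ 1 - Real.exp (-(s * y)) :=
      sub_nonneg.2 (Real.exp_le_one_iff.2 (neg_nonpos.2 (mul_nonneg hs.le hy)))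
    have hxd : 0 ≤ x + d := add_nonneg hx hd
    have h1 := hcdf hμ hx
    have h2 := hcdf hν hx
    have h3 := hcdf (add_pos hμ hν) hx
    have h4 := hcdf hν hxd
    simp only [hx, hxd, if_true]
    rw [← ENNReal.ofReal_mul h1, ← ENNReal.ofReal_mul (by positivity),
      ← ENNReal.ofReal_mul (by positivity), ← ENNReal.ofReal_add (by positivity) (by positivity),
      ← ENNReal.ofReal_add (by positivity) (by positivity)]
    simp only [add_mul, mul_add, neg_add, Real.exp_add]
    congr 1
    ring

theorem integral_max_sub_prod_expMeasure {μ ν d : ℝ} (hμ : 0 < μ) (hν : 0 < ν) (hd : 0 ≤ d)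
    {g : ℝ → ℝ} (hg : ∀ r, 0 < r → Integrable g (expMeasure r)) :
    ∫ w, g (max w.1 (w.2 - d)) ∂(expMeasure μ).prod (expMeasure ν) =
      ∫ x, g x ∂expMeasure μ +
        Real.exp (-(ν * d)) * (∫ x, g x ∂expMeasure ν - ∫ x, g x ∂expMeasure (μ + ν)) := by
  have hmap := map_max_sub_prod_expMeasure_add hμ hν hd
  set ρ := ((expMeasure μ).prod (expMeasure ν)).map fun w => max w.1 (w.2 - d) with hρ
  have hgs {r : ℝ} (hr : 0 < r) :
      Integrable g (ENNReal.ofReal (Real.exp (-(ν * d))) • expMeasure r) :=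
    (hg r hr).smul_measure ENNReal.ofReal_ne_top
  have hgρ : Integrable g ρ :=
    ((hg μ hμ).add_measure (hgs hν)).mono_measure (hmap ▸ Measure.le_add_right le_rfl)
  have hint := congrArg (fun τ => ∫ x, g x ∂τ) hmap
  simp only [integral_add_measure hgρ (hgs (add_pos hμ hν)),
    integral_add_measure (hg μ hμ) (hgs hν), integral_smul_measure,
    ENNReal.toReal_ofReal (Real.exp_nonneg _), smul_eq_mul] at hint
  rw [← integral_map (φ := fun w : ℝ × ℝ => max w.1 (w.2 - d)) (by fun_prop)
    hgρ.aestronglyMeasurable, ← hρ]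
  linarith

end Exponential

section PoissonEquation

/-- The value of the Lyapunov exponent: the mean of the chain `d ↦ max A (B - d)`, with independent
`A ∼ Exp(μ)` and `B ∼ Exp(ν)`, in its stationary regime. -/
noncomputable def growthRate (μ ν : ℝ) : ℝ :=
  (2 * μ ^ 4 + 7 * μ ^ 3 * ν + 10 * μ ^ 2 * ν ^ 2 + 11 * μ * ν ^ 3 + 4 * ν ^ 4) /
    (μ * ν * (μ + ν) ^ 2 * (3 * μ + 4 * ν))

/-- The coefficient `θ` of the solution `bias` of the Poisson equation, determined by
`θ = 1 / ν - 1 / (μ + ν) + θ * (1 / 2 - (μ + ν) / (μ + 2 * ν))`. -/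
noncomputable def biasCoeff (μ ν : ℝ) : ℝ :=
  2 * μ * (μ + 2 * ν) / (ν * (μ + ν) * (3 * μ + 4 * ν))

/-- The solution `h` of the Poisson equation `E (M + h M) = growthRate μ ν + h d` of the chain
`d ↦ M = max A (B - d)`. -/
noncomputable def bias (μ ν d : ℝ) : ℝ :=
  biasCoeff μ ν * Real.exp (-(ν * d))

/-- One step of the chain from the state `d`, compensated by the Poisson equation so that it has
mean zero when `w` is distributed as `Exp(μ) × Exp(ν)`. -/
noncomputable def centeredStep (μ ν d : ℝ) (w : ℝ × ℝ) : ℝ :=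
  max w.1 (w.2 - d) + bias μ ν (max w.1 (w.2 - d)) - (growthRate μ ν + bias μ ν d)

theorem measurable_uncurry_centeredStep (μ ν : ℝ) :
    Measurable (Function.uncurry (centeredStep μ ν)) := by
  unfold Function.uncurry centeredStep bias
  fun_prop

variable {μ ν : ℝ}

theorem growthRate_nonneg (hμ : 0 < μ) (hν : 0 < ν) : 0 ≤ growthRate μ ν := by
  unfold growthRate
  positivity

theorem biasCoeff_nonneg (hμ : 0 < μ) (hν : 0 < ν) : 0 ≤ biasCoeff μ ν := by
  unfold biasCoeff
  positivity

theorem bias_nonneg (hμ : 0 < μ) (hν : 0 < ν) (d : ℝ) : 0 ≤ bias μ ν d :=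
  mul_nonneg (biasCoeff_nonneg hμ hν) (Real.exp_nonneg _)

theorem bias_le_biasCoeff (hμ : 0 < μ) (hν : 0 < ν) {d : ℝ} (hd : 0 ≤ d) :
    bias μ ν d ≤ biasCoeff μ ν :=
  mul_le_of_le_one_right (biasCoeff_nonneg hμ hν)
    (Real.exp_le_one_iff.2 (neg_nonpos.2 (mul_nonneg hν.le hd)))

theorem integrable_add_bias_expMeasure (hν : 0 < ν) {r : ℝ} (hr : 0 < r) :
    Integrable (fun x => x + bias μ ν x) (expMeasure r) := by
  have := isProbabilityMeasure_expMeasure hr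
  exact ((memLp_two_id_expMeasure hr).integrable one_le_two).add
    ((integrable_exp_expMeasure hr hν.le).const_mul _)

theorem integral_add_bias_expMeasure (hν : 0 < ν) {r : ℝ} (hr : 0 < r) :
    ∫ x, (x + bias μ ν x) ∂(expMeasure r) = 1 / r + biasCoeff μ ν * (r / (r + ν)) := by
  have := isProbabilityMeasure_expMeasure hr
  unfold bias
  rw [integral_add ((memLp_two_id_expMeasure hr).integrable one_le_two)
    ((integrable_exp_expMeasure hr hν.le).const_mul _), integral_const_mul,
    integral_id_expMeasure hr, integral_exp_expMeasure hr hν.le]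

theorem poisson_equation (hμ : 0 < μ) (hν : 0 < ν) {d : ℝ} (hd : 0 ≤ d) :
    ∫ w, (max w.1 (w.2 - d) + bias μ ν (max w.1 (w.2 - d)))
      ∂(expMeasure μ).prod (expMeasure ν) = growthRate μ ν + bias μ ν d := by
  have hμν : 0 < μ + ν := add_pos hμ hν
  rw [integral_max_sub_prod_expMeasure hμ hν hd (g := fun x => x + bias μ ν x)
    fun r hr => integrable_add_bias_expMeasure hν hr,
    integral_add_bias_expMeasure hν hμ, integral_add_bias_expMeasure hν hν,
    integral_add_bias_expMeasure hν hμν]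
  have hrate : 1 / μ + biasCoeff μ ν * (μ / (μ + ν)) = growthRate μ ν := by
    unfold biasCoeff growthRate
    field_simp
    ring
  have hcoeff : 1 / ν + biasCoeff μ ν * (ν / (ν + ν)) -
      (1 / (μ + ν) + biasCoeff μ ν * ((μ + ν) / (μ + ν + ν))) = biasCoeff μ ν := by
    unfold biasCoeff
    field_simp
    ring
  rw [hrate, hcoeff, bias, mul_comm (Real.exp _)]

theorem abs_centeredStep_le (hμ : 0 < μ) (hν : 0 < ν) {d : ℝ} (hd : 0 ≤ d) {w : ℝ × ℝ}
    (hw₁ : 0 ≤ w.1) (hw₂ : 0 ≤ w.2) :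
    |centeredStep μ ν d w| ≤ w.1 + w.2 + (growthRate μ ν + biasCoeff μ ν) := by
  have hnonneg : 0 ≤ max w.1 (w.2 - d) := le_max_of_le_left hw₁
  have hle : max w.1 (w.2 - d) ≤ w.1 + w.2 := max_le (by linarith) (by linarith)
  have := growthRate_nonneg hμ hν
  have := bias_nonneg hμ hν d
  have := bias_nonneg hμ hν (max w.1 (w.2 - d))
  have := bias_le_biasCoeff hμ hν hd
  have := bias_le_biasCoeff hμ hν hnonneg
  rw [centeredStep, abs_le]
  constructor <;> linarith

theorem memLp_two_add_add_const_prod_expMeasure (hμ : 0 < μ) (hν : 0 < ν) (c : ℝ) :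
    MemLp (fun w : ℝ × ℝ => w.1 + w.2 + c) 2 ((expMeasure μ).prod (expMeasure ν)) := by
  have := isProbabilityMeasure_expMeasure hμ
  have := isProbabilityMeasure_expMeasure hν
  exact (((memLp_two_id_expMeasure hμ).comp_fst _).add
    ((memLp_two_id_expMeasure hν).comp_snd _)).add (memLp_const c)

theorem integrable_centeredStep (hμ : 0 < μ) (hν : 0 < ν) {d : ℝ} (hd : 0 ≤ d) :
    Integrable (centeredStep μ ν d) ((expMeasure μ).prod (expMeasure ν)) := by
  have := isProbabilityMeasure_expMeasure hμ
  have := isProbabilityMeasure_expMeasure hν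
  refine ((memLp_two_add_add_const_prod_expMeasure hμ hν
    (growthRate μ ν + biasCoeff μ ν)).integrable one_le_two).mono'
    ((measurable_uncurry_centeredStep μ ν).of_uncurry_left).aestronglyMeasurable ?_
  filter_upwards [Measure.quasiMeasurePreserving_fst.ae (ae_nonneg_expMeasure μ),
    Measure.quasiMeasurePreserving_snd.ae (ae_nonneg_expMeasure ν)] with w hw₁ hw₂
  exact abs_centeredStep_le hμ hν hd hw₁ hw₂

theorem integral_centeredStep (hμ : 0 < μ) (hν : 0 < ν) {d : ℝ} (hd : 0 ≤ d) :
    ∫ w, centeredStep μ ν d w ∂(expMeasure μ).prod (expMeasure ν) = 0 := by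
  have := isProbabilityMeasure_expMeasure hμ
  have := isProbabilityMeasure_expMeasure hν
  have hstep : Integrable (fun w => centeredStep μ ν d w + (growthRate μ ν + bias μ ν d))
      ((expMeasure μ).prod (expMeasure ν)) :=
    (integrable_centeredStep hμ hν hd).add (integrable_const _)
  calc ∫ w, centeredStep μ ν d w ∂(expMeasure μ).prod (expMeasure ν)
    _ = ∫ w, (max w.1 (w.2 - d) + bias μ ν (max w.1 (w.2 - d)))
          ∂(expMeasure μ).prod (expMeasure ν) - (growthRate μ ν + bias μ ν d) := by
      simp only [centeredStep, sub_add_cancel] at hstep ⊢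
      rw [integral_sub hstep (integrable_const _), integral_const, probReal_univ, one_smul]
    _ = 0 := by rw [poisson_equation hμ hν hd, sub_self]

end PoissonEquation

section Recursion

/-- The pairs `W n` driving a recursion adapted to `ℱ`: `W n` is independent of `ℱ n`, becomes known
at time `n + 1`, and has independent nonnegative components distributed as `Exp(μ)` and `Exp(ν)`. -/
structure IsExpInnovation {Ω : Type*} {mΩ : MeasurableSpace Ω} (ℱ : Filtration ℕ mΩ)
    (P : Measure Ω) (μ ν : ℝ) (W : ℕ → Ω → ℝ × ℝ) : Prop where
  measurable : ∀ n, Measurable[ℱ (n + 1)] (W n)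
  fst_nonneg : ∀ n ω, 0 ≤ (W n ω).1
  snd_nonneg : ∀ n ω, 0 ≤ (W n ω).2
  hasLaw : ∀ n, HasLaw (W n) ((expMeasure μ).prod (expMeasure ν)) P
  indep : ∀ n, Indep (ℱ n) (MeasurableSpace.comap (W n) inferInstance) P

variable {Ω : Type*} {mΩ : MeasurableSpace Ω} {P : Measure Ω} [IsProbabilityMeasure P] {μ ν : ℝ}
  {ℱ : Filtration ℕ mΩ} {W : ℕ → Ω → ℝ × ℝ}

theorem ae_tendsto_average_centeredStep {D : ℕ → Ω → ℝ} (hμ : 0 < μ) (hν : 0 < ν)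
    (hD : ∀ n, Measurable[ℱ n] (D n)) (hD₀ : ∀ n ω, 0 ≤ D n ω)
    (hW : IsExpInnovation ℱ P μ ν W) :
    ∀ᵐ ω ∂P, Tendsto
      (fun n : ℕ => (∑ k ∈ Finset.range n, centeredStep μ ν (D k ω) (W k ω)) / n) atTop (𝓝 0) := by
  set c := growthRate μ ν + biasCoeff μ ν
  have hdom := memLp_two_add_add_const_prod_expMeasure hμ hν c
  have hξm (n : ℕ) :
      StronglyMeasurable[ℱ (n + 1)] fun ω => centeredStep μ ν (D n ω) (W n ω) :=
    ((measurable_uncurry_centeredStep μ ν).comp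
      (((hD n).mono (ℱ.mono n.le_succ) le_rfl).prodMk (hW.measurable n))).stronglyMeasurable
  have hbound (n : ℕ) (ω : Ω) :
      |centeredStep μ ν (D n ω) (W n ω)| ≤ (W n ω).1 + (W n ω).2 + c :=
    abs_centeredStep_le hμ hν (hD₀ n ω) (hW.fst_nonneg n ω) (hW.snd_nonneg n ω)
  have hboundL (n : ℕ) : MemLp (fun ω => (W n ω).1 + (W n ω).2 + c) 2 P :=
    ((hW.hasLaw n).map_eq ▸ hdom).comp_of_map (hW.hasLaw n).aemeasurable
  have hξL (n : ℕ) : MemLp (fun ω => centeredStep μ ν (D n ω) (W n ω)) 2 P :=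
    (hboundL n).mono' ((hξm n).mono (ℱ.le _)).aestronglyMeasurable (ae_of_all _ (hbound n))
  refine ae_tendsto_average_zero_of_condExp_eq_zero (ℱ := ℱ) hξm hξL (fun n => ?_)
    (C := ∫ w, (w.1 + w.2 + c) ^ 2 ∂(expMeasure μ).prod (expMeasure ν)) fun n => ?_
  · filter_upwards [condExp_comp_prodMk_of_indep (ℱ.le n) (hD n)
      ((hW.measurable n).mono (ℱ.le _) le_rfl) (hW.indep n)
      (measurable_uncurry_centeredStep μ ν).stronglyMeasurable
      ((hξL n).integrable one_le_two)] with ω hω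
    refine hω.trans ?_
    rw [(hW.hasLaw n).map_eq]
    exact integral_centeredStep hμ hν (hD₀ n ω)
  · calc ∫ ω, centeredStep μ ν (D n ω) (W n ω) ^ 2 ∂P
      _ ≤ ∫ ω, ((W n ω).1 + (W n ω).2 + c) ^ 2 ∂P :=
        integral_mono (hξL n).integrable_sq (hboundL n).integrable_sq fun ω =>
          sq_le_sq' (neg_le_of_abs_le (hbound n ω)) (le_of_abs_le (hbound n ω))
      _ = ∫ w, (w.1 + w.2 + c) ^ 2 ∂(expMeasure μ).prod (expMeasure ν) :=
        (hW.hasLaw n).integral_comp hdom.integrable_sq.aestronglyMeasurable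

theorem tendsto_succ_div_iff {u : ℕ → ℝ} {l : ℝ} :
    Tendsto (fun n : ℕ => u (n + 1) / n) atTop (𝓝 l) ↔
      Tendsto (fun n : ℕ => u n / n) atTop (𝓝 l) := by
  have hratio : Tendsto (fun n : ℕ => (n : ℝ) / (n + 1)) atTop (𝓝 1) :=
    tendsto_natCast_div_add_atTop 1
  rw [← tendsto_add_atTop_iff_nat (f := fun n : ℕ => u n / n) 1]
  constructor <;> intro h
  · refine (mul_one l ▸ h.mul hratio).congr' ?_
    filter_upwards [eventually_ne_atTop 0] with n hn
    push_cast
    field_simp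
  · refine (div_one l ▸ h.div hratio one_ne_zero).congr' ?_
    filter_upwards [eventually_ne_atTop 0] with n hn
    rw [Pi.div_apply]
    push_cast
    field_simp

theorem tendsto_average_of_tendsto_average_centeredStep {d : ℕ → ℝ} {w : ℕ → ℝ × ℝ} (hμ : 0 < μ)
    (hν : 0 < ν) (hd : ∀ n, 0 ≤ d n) (hrec : ∀ n, d (n + 1) = max (w n).1 ((w n).2 - d n))
    (h : Tendsto (fun n : ℕ => (∑ k ∈ Finset.range n, centeredStep μ ν (d k) (w k)) / n)
      atTop (𝓝 0)) :
    Tendsto (fun n : ℕ => (∑ k ∈ Finset.range n, d (k + 1)) / n) atTop (𝓝 (growthRate μ ν)) := by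
  have hsum (n : ℕ) : ∑ k ∈ Finset.range n, d (k + 1) =
      ∑ k ∈ Finset.range n, centeredStep μ ν (d k) (w k) + n * growthRate μ ν +
        (bias μ ν (d 0) - bias μ ν (d n)) := by
    have htel := Finset.sum_range_sub' (fun k => bias μ ν (d k)) n
    simp only [centeredStep, ← hrec, Finset.sum_sub_distrib, Finset.sum_add_distrib,
      Finset.sum_const, Finset.card_range, nsmul_eq_mul] at htel ⊢
    linarith
  have hbias : Tendsto (fun n : ℕ => (bias μ ν (d 0) - bias μ ν (d n)) / n) atTop (𝓝 0) := by
    refine tendsto_bdd_div_atTop_nhds_zero (b := -biasCoeff μ ν) (B := biasCoeff μ ν)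
      (.of_forall fun n => ?_) (.of_forall fun n => ?_) tendsto_natCast_atTop_atTop
    · linarith [bias_nonneg hμ hν (d 0), bias_le_biasCoeff hμ hν (hd n)]
    · linarith [bias_nonneg hμ hν (d n), bias_le_biasCoeff hμ hν (hd 0)]
  have := (h.add_const (growthRate μ ν)).add hbias
  rw [zero_add, add_zero] at this
  refine this.congr' ?_
  filter_upwards [eventually_ne_atTop 0] with n hn
  rw [hsum]
  field_simp

theorem ae_tendsto_div_of_maxPlus_recursion {u : ℕ → Ω → ℝ} (hμ : 0 < μ) (hν : 0 < ν)
    (hu₀ : Measurable[ℱ 0] (u 0)) (hu₁ : Measurable[ℱ 0] (u 1)) (hu : ∀ ω, u 0 ω ≤ u 1 ω)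
    (hrec : ∀ n ω, u (n + 2) ω = max (u (n + 1) ω + (W n ω).1) (u n ω + (W n ω).2))
    (hW : IsExpInnovation ℱ P μ ν W) :
    ∀ᵐ ω ∂P, Tendsto (fun n : ℕ => u n ω / n) atTop (𝓝 (growthRate μ ν)) := by
  set D : ℕ → Ω → ℝ := fun n ω => u (n + 1) ω - u n ω with hD
  have hDrec (n : ℕ) (ω : Ω) : D (n + 1) ω = max (W n ω).1 ((W n ω).2 - D n ω) := by
    simp only [hD, hrec n ω, ← max_sub_sub_right]
    congr 1 <;> ring
  have hDm (n : ℕ) : Measurable[ℱ n] (D n) := by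
    induction n with
    | zero => exact hu₁.sub hu₀
    | succ n ih =>
      rw [funext (hDrec n)]
      exact (hW.measurable n).fst.max
        ((hW.measurable n).snd.sub (ih.mono (ℱ.mono n.le_succ) le_rfl))
  have hD₀ (n : ℕ) (ω : Ω) : 0 ≤ D n ω := by
    cases n with
    | zero => exact sub_nonneg.2 (hu ω)
    | succ n => exact hDrec n ω ▸ le_max_of_le_left (hW.fst_nonneg n ω)
  filter_upwards [ae_tendsto_average_centeredStep hμ hν hDm hD₀ hW] with ω hω
  have havg := tendsto_average_of_tendsto_average_centeredStep hμ hν (fun n => hD₀ n ω)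
    (fun n => hDrec n ω) hω
  have hsum (n : ℕ) : ∑ k ∈ Finset.range n, D (k + 1) ω = u (n + 1) ω - u 1 ω :=
    Finset.sum_range_sub (fun k => u (k + 1) ω) n
  have hsucc := havg.add (tendsto_const_div_atTop_nhds_zero_nat (u 1 ω))
  simp only [hsum, ← add_div, sub_add_cancel, add_zero] at hsucc
  exact tendsto_succ_div_iff.1 hsucc

end Recursion

section Inputs

variable {Ω : Type*} {mΩ : MeasurableSpace Ω} {P : Measure Ω}
  {ι κ E : Type*} [Preorder κ] [mE : MeasurableSpace E] {X : ι → Ω → E} {J : κ → Set ι}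

/-- The filtration of the information carried by the variables `X i` with index in a growing
set `J n`. -/
def revealedFiltration (X : ι → Ω → E) (hX : ∀ i, Measurable (X i)) (J : κ → Set ι)
    (hJ : Monotone J) : Filtration κ mΩ where
  seq n := ⨆ i ∈ J n, mE.comap (X i)
  mono' _ _ h := biSup_mono fun _ hi => hJ h hi
  le' _ := iSup₂_le fun i _ => (hX i).comap_le

theorem measurable_revealedFiltration (hX : ∀ i, Measurable (X i)) (hJ : Monotone J) {n : κ}
    {i : ι} (hi : i ∈ J n) :
    Measurable[revealedFiltration X hX J hJ n] (X i) :=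
  (comap_measurable (X i)).mono
    (le_iSup₂_of_le (f := fun i (_ : i ∈ J n) => mE.comap (X i)) i hi le_rfl) le_rfl

theorem indep_revealedFiltration_prodMk (hX : ∀ i, Measurable (X i)) (hJ : Monotone J)
    (hind : iIndepFun X P) {n : κ} {i j : ι} (hi : i ∉ J n) (hj : j ∉ J n) :
    Indep (revealedFiltration X hX J hJ n)
      (MeasurableSpace.comap (fun ω => (X i ω, X j ω)) inferInstance) P := by
  have hdisj : Disjoint (J n) {i, j} := by
    simp [Set.disjoint_right, hi, hj]
  exact indep_of_indep_of_le_right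
    (indep_iSup_of_disjoint (fun i => (hX i).comap_le) hind.iIndep hdisj)
    ((MeasurableSpace.comap_prodMk (X i) (X j)).trans_le
      (iSup_pair (f := fun i => mE.comap (X i))).ge)

/-- The random entries of the system: two families of nonnegative random variables with laws
`Exp(μ)` and `Exp(ν)`, all of them mutually independent. -/
structure IsExpInput {Ω : Type*} [MeasurableSpace Ω] (P : Measure Ω) (μ ν : ℝ)
    (α β : ℕ → Ω → ℝ) : Prop where
  measurable : ∀ i, Measurable (Sum.elim α β i)
  nonneg_left : ∀ n ω, 0 ≤ α n ω
  nonneg_right : ∀ n ω, 0 ≤ β n ω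
  hasLaw_left : ∀ n, HasLaw (α n) (expMeasure μ) P
  hasLaw_right : ∀ n, HasLaw (β n) (expMeasure ν) P
  iIndepFun : iIndepFun (Sum.elim α β) P

/-- The indices of the inputs `α k` with `k < n + m` and `β k` with `k < n`. -/
def delayedPast (m n : ℕ) : Set (ℕ ⊕ ℕ) := {i | Sum.elim (· < n + m) (· < n) i}

theorem monotone_delayedPast (m : ℕ) : Monotone (delayedPast m) := by
  rintro n n' h (k | k) hk
  · exact lt_of_lt_of_le hk (Nat.add_le_add_right h m)
  · exact lt_of_lt_of_le hk h

theorem IsExpInput.isExpInnovation [IsProbabilityMeasure P] {μ ν : ℝ} {α β : ℕ → Ω → ℝ}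
    (h : IsExpInput P μ ν α β) (m : ℕ) :
    IsExpInnovation (revealedFiltration (Sum.elim α β) h.measurable _ (monotone_delayedPast m))
      P μ ν fun n ω => (α (n + m) ω, β n ω) where
  measurable n :=
    (measurable_revealedFiltration h.measurable (monotone_delayedPast m) (i := .inl (n + m))
      (show n + m < n + 1 + m by omega)).prodMk
    (measurable_revealedFiltration h.measurable (monotone_delayedPast m) (i := .inr n)
      (show n < n + 1 by omega))
  fst_nonneg n := h.nonneg_left (n + m)
  snd_nonneg n := h.nonneg_right n
  hasLaw n :=
    (h.iIndepFun.indepFun (i := .inl (n + m)) (j := .inr n) Sum.inl_ne_inr).hasLaw_prod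
      (h.hasLaw_left _) (h.hasLaw_right _)
  indep n := indep_revealedFiltration_prodMk h.measurable (monotone_delayedPast m) h.iIndepFun
    (i := .inl (n + m)) (j := .inr n) (lt_irrefl (n + m)) (lt_irrefl n)

theorem exists_measurable_nonneg_ae_eq_of_hasLaw_expMeasure {r : ℝ} {Y : ℕ → Ω → ℝ}
    (hY : ∀ n, HasLaw (Y n) (expMeasure r) P) :
    ∃ Y' : ℕ → Ω → ℝ, (∀ n, Measurable (Y' n)) ∧ (∀ n ω, 0 ≤ Y' n ω) ∧ ∀ n, Y' n =ᵐ[P] Y n := by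
  have hnonneg (n : ℕ) : 0 ≤ᵐ[P] Y n :=
    ((hY n).ae_iff measurableSet_Ici.mem).2 (ae_nonneg_expMeasure r)
  choose Y' hm h0 hae using fun n => (hY n).aemeasurable.exists_measurable_nonneg (hnonneg n)
  exact ⟨Y', hm, h0, fun n => (hae n).symm⟩

theorem exists_isExpInput_ae_eq {μ ν : ℝ} {α β : ℕ → Ω → ℝ}
    (hα : ∀ n, HasLaw (α n) (expMeasure μ) P) (hβ : ∀ n, HasLaw (β n) (expMeasure ν) P)
    (hind : iIndepFun (Sum.elim α β : ℕ ⊕ ℕ → Ω → ℝ) P) :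
    ∃ α' β', IsExpInput P μ ν α' β' ∧ (∀ n, α' n =ᵐ[P] α n) ∧ ∀ n, β' n =ᵐ[P] β n := by
  obtain ⟨α', hαm, hα0, hαe⟩ := exists_measurable_nonneg_ae_eq_of_hasLaw_expMeasure hα
  obtain ⟨β', hβm, hβ0, hβe⟩ := exists_measurable_nonneg_ae_eq_of_hasLaw_expMeasure hβ
  exact ⟨α', β', ⟨Sum.forall.2 ⟨hαm, hβm⟩, hα0, hβ0, fun n => (hα n).congr (hαe n),
    fun n => (hβ n).congr (hβe n),
    hind.congr (Sum.forall.2 ⟨fun n => (hαe n).symm, fun n => (hβe n).symm⟩)⟩, hαe, hβe⟩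

end Inputs

section StateVector

variable {Ω : Type*} {α β γ : ℕ → Ω → ℝ}

/-- The matrices of part (1), with rows `(α k, β k)` and `(0, 0)`. -/
def firstRowMatrix (α β : ℕ → Ω → ℝ) : ℕ → Ω → Matrix (Fin 2) (Fin 2) ℝ :=
  fun k ω => !![α k ω, β k ω; 0, 0]

/-- The matrices of part (2), with columns `(α k, γ k)` and `(0, 0)`. -/
def firstColumnMatrix (α γ : ℕ → Ω → ℝ) : ℕ → Ω → Matrix (Fin 2) (Fin 2) ℝ :=
  fun k ω => !![α k ω, 0; γ k ω, 0]

theorem stateVector_firstRowMatrix_succ_zero (n : ℕ) (ω : Ω) :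
    stateVector (firstRowMatrix α β) (n + 1) ω 0 =
      max (stateVector (firstRowMatrix α β) n ω 0 + α n ω)
        (stateVector (firstRowMatrix α β) n ω 1 + β n ω) := by
  simp [stateVector, maxPlusMulVec, firstRowMatrix]

theorem stateVector_firstRowMatrix_succ_one (n : ℕ) (ω : Ω) :
    stateVector (firstRowMatrix α β) (n + 1) ω 1 =
      max (stateVector (firstRowMatrix α β) n ω 0) (stateVector (firstRowMatrix α β) n ω 1) := by
  simp [stateVector, maxPlusMulVec, firstRowMatrix]

theorem stateVector_firstRowMatrix_one_le_zero (hα : ∀ n ω, 0 ≤ α n ω) (hβ : ∀ n ω, 0 ≤ β n ω)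
    (n : ℕ) (ω : Ω) :
    stateVector (firstRowMatrix α β) n ω 1 ≤ stateVector (firstRowMatrix α β) n ω 0 := by
  cases n with
  | zero => exact le_rfl
  | succ n =>
    rw [stateVector_firstRowMatrix_succ_zero, stateVector_firstRowMatrix_succ_one]
    exact max_le_max (le_add_of_nonneg_right (hα n ω)) (le_add_of_nonneg_right (hβ n ω))

theorem stateVector_firstColumnMatrix_succ_zero (n : ℕ) (ω : Ω) :
    stateVector (firstColumnMatrix α γ) (n + 1) ω 0 =
      max (stateVector (firstColumnMatrix α γ) n ω 0 + α n ω)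
        (stateVector (firstColumnMatrix α γ) n ω 1) := by
  simp [stateVector, maxPlusMulVec, firstColumnMatrix]

theorem stateVector_firstColumnMatrix_succ_one (n : ℕ) (ω : Ω) :
    stateVector (firstColumnMatrix α γ) (n + 1) ω 1 =
      max (stateVector (firstColumnMatrix α γ) n ω 0 + γ n ω)
        (stateVector (firstColumnMatrix α γ) n ω 1) := by
  simp [stateVector, maxPlusMulVec, firstColumnMatrix]

theorem stateVector_firstColumnMatrix_add_two_zero (hα : ∀ n ω, 0 ≤ α n ω) (n : ℕ) (ω : Ω) :
    stateVector (firstColumnMatrix α γ) (n + 2) ω 0 =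
      max (stateVector (firstColumnMatrix α γ) (n + 1) ω 0 + α (n + 1) ω)
        (stateVector (firstColumnMatrix α γ) n ω 0 + γ n ω) := by
  have hone : stateVector (firstColumnMatrix α γ) n ω 1 ≤
      stateVector (firstColumnMatrix α γ) (n + 1) ω 0 + α (n + 1) ω := by
    rw [stateVector_firstColumnMatrix_succ_zero]
    exact le_add_of_le_of_nonneg (le_max_right _ _) (hα (n + 1) ω)
  rw [stateVector_firstColumnMatrix_succ_zero, stateVector_firstColumnMatrix_succ_one,
    max_left_comm, max_eq_left hone, max_comm]

end StateVector

section LyapunovExponent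

variable {Ω : Type*} [MeasurableSpace Ω] {P : Measure Ω}

theorem IsLyapunovExponent.congr {A A' : ℕ → Ω → Matrix (Fin 2) (Fin 2) ℝ} {lam : ℝ}
    (h : IsLyapunovExponent P A lam) (hA : ∀ k, A k =ᵐ[P] A' k) :
    IsLyapunovExponent P A' lam := by
  filter_upwards [h, ae_all_iff.2 hA] with ω hω hAω
  have hstate (k : ℕ) : stateVector A' k ω = stateVector A k ω := by
    induction k with
    | zero => rfl
    | succ k ih => simp only [stateVector, ih, hAω]
  simpa only [hstate] using hω

theorem isLyapunovExponent_of_le_of_le_succ {A : ℕ → Ω → Matrix (Fin 2) (Fin 2) ℝ} {lam : ℝ}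
    {u : ℕ → Ω → ℝ} (hu : ∀ᵐ ω ∂P, Tendsto (fun n : ℕ => u n ω / n) atTop (𝓝 lam))
    (hlow : ∀ n ω, u n ω ≤ max (stateVector A n ω 0) (stateVector A n ω 1))
    (hupp : ∀ n ω, max (stateVector A n ω 0) (stateVector A n ω 1) ≤ u (n + 1) ω) :
    IsLyapunovExponent P A lam := by
  filter_upwards [hu] with ω hω
  simp only [one_div_mul_eq_div]
  refine tendsto_of_tendsto_of_tendsto_of_le_of_le hω (tendsto_succ_div_iff.2 hω)
    (fun n => ?_) fun n => ?_
  · exact div_le_div_of_nonneg_right (hlow n ω) n.cast_nonneg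
  · exact div_le_div_of_nonneg_right (hupp n ω) n.cast_nonneg

variable [IsProbabilityMeasure P] {μ ν σ : ℝ} {α β γ : ℕ → Ω → ℝ}

theorem IsExpInput.isLyapunovExponent_firstRowMatrix
    (h : IsExpInput P μ ν α β) (hμ : 0 < μ) (hν : 0 < ν) :
    IsLyapunovExponent P (firstRowMatrix α β) (growthRate μ ν) := by
  have hmax (n : ℕ) (ω : Ω) := stateVector_firstRowMatrix_succ_one (α := α) (β := β) n ω
  have hone (n : ℕ) (ω : Ω) : stateVector (firstRowMatrix α β) (n + 1) ω 1 =
      stateVector (firstRowMatrix α β) n ω 0 := by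
    rw [hmax, max_eq_left (stateVector_firstRowMatrix_one_le_zero h.nonneg_left h.nonneg_right n ω)]
  refine isLyapunovExponent_of_le_of_le_succ
    (u := fun n ω => stateVector (firstRowMatrix α β) n ω 1)
    (ae_tendsto_div_of_maxPlus_recursion hμ hν measurable_const ?_ (fun ω => ?_) (fun n ω => ?_)
      (h.isExpInnovation 0))
    (fun n ω => le_max_right _ _) (fun n ω => (hmax n ω).ge)
  · simp only [hone]
    exact measurable_const
  · exact (le_max_right _ _).trans (hmax 0 ω).ge
  · rw [hone, hone, stateVector_firstRowMatrix_succ_zero, add_zero]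

theorem IsExpInput.isLyapunovExponent_firstColumnMatrix
    (h : IsExpInput P μ σ α γ) (hμ : 0 < μ) (hσ : 0 < σ) :
    IsLyapunovExponent P (firstColumnMatrix α γ) (growthRate μ σ) := by
  have hmax (n : ℕ) (ω : Ω) :
      max (stateVector (firstColumnMatrix α γ) n ω 0) (stateVector (firstColumnMatrix α γ) n ω 1) ≤
        stateVector (firstColumnMatrix α γ) (n + 1) ω 0 := by
    rw [stateVector_firstColumnMatrix_succ_zero]
    exact max_le_max_right _ (le_add_of_nonneg_right (h.nonneg_left n ω))
  refine isLyapunovExponent_of_le_of_le_succ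
    (u := fun n ω => stateVector (firstColumnMatrix α γ) n ω 0)
    (ae_tendsto_div_of_maxPlus_recursion hμ hσ measurable_const ?_ (fun ω => ?_)
      (stateVector_firstColumnMatrix_add_two_zero h.nonneg_left) (h.isExpInnovation 1))
    (fun n ω => le_max_left _ _) hmax
  · have hinit : (fun ω => stateVector (firstColumnMatrix α γ) 1 ω 0) = α 0 := by
      ext ω
      simp [stateVector, maxPlusMulVec, firstColumnMatrix, h.nonneg_left 0 ω]
    exact hinit ▸ measurable_revealedFiltration h.measurable (monotone_delayedPast 1)
      (i := .inl 0) (show 0 < 0 + 1 from one_pos)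
  · exact (le_max_left _ _).trans (hmax 0 ω)

end LyapunovExponent

theorem mainTheorem5 {Ω : Type*} [MeasurableSpace Ω] (P : Measure Ω) [IsProbabilityMeasure P]
    (μ : ℝ) (hμ : 0 < μ) (α : ℕ → Ω → ℝ) (hα : ∀ k, HasLaw (α k) (expMeasure μ) P) :
    (∀ (ν : ℝ) (β : ℕ → Ω → ℝ), 0 < ν →
      (∀ k, HasLaw (β k) (expMeasure ν) P) →
      iIndepFun (Sum.elim α β : ℕ ⊕ ℕ → Ω → ℝ) P →
      IsLyapunovExponent P (fun k ω => !![α k ω, β k ω; 0, 0])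
        ((2 * μ ^ 4 + 7 * μ ^ 3 * ν + 10 * μ ^ 2 * ν ^ 2 + 11 * μ * ν ^ 3 + 4 * ν ^ 4) /
          (μ * ν * (μ + ν) ^ 2 * (3 * μ + 4 * ν)))) ∧
    (∀ (σ : ℝ) (γ : ℕ → Ω → ℝ), 0 < σ →
      (∀ k, HasLaw (γ k) (expMeasure σ) P) →
      iIndepFun (Sum.elim α γ : ℕ ⊕ ℕ → Ω → ℝ) P →
      IsLyapunovExponent P (fun k ω => !![α k ω, 0; γ k ω, 0])
        ((2 * μ ^ 4 + 7 * μ ^ 3 * σ + 10 * μ ^ 2 * σ ^ 2 + 11 * μ * σ ^ 3 + 4 * σ ^ 4) /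
          (μ * σ * (μ + σ) ^ 2 * (3 * μ + 4 * σ)))) := by
  refine ⟨fun ν β hν hβ hind => ?_, fun σ γ hσ hγ hind => ?_⟩
  · obtain ⟨α', β', hinput, hαe, hβe⟩ := exists_isExpInput_ae_eq hα hβ hind
    refine (hinput.isLyapunovExponent_firstRowMatrix hμ hν).congr fun k => ?_
    filter_upwards [hαe k, hβe k] with ω hαω hβω
    rw [firstRowMatrix, hαω, hβω]
  · obtain ⟨α', γ', hinput, hαe, hγe⟩ := exists_isExpInput_ae_eq hα hγ hind
    refine (hinput.isLyapunovExponent_firstColumnMatrix hμ hσ).congr fun k => ?_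
    filter_upwards [hαe k, hγe k] with ω hαω hγω
    rw [firstColumnMatrix, hαω, hγω]
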